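/- Let $w=(w(k))_{k\in\mathbb Z}$ be a finitely supported weight vector with $0\le w(k)<1$ for all $k$, $\sum_k w(k)=1$ and span $1$, i.e. the largest integer $d\ge 1$ for which the support of $w$ is contained in $\ell+d\mathbb Z$ for some $\ell\in\mathbb Z$ is $d=1$. Let $\{\xi_t(k)\}_{t,k\in\mathbb Z}$ be i.i.d. real random variables with mean zero and finite variance. For $s\in\mathbb Z$ let $h_{[s,s]}\equiv 0$ and, for $t\ge s$, $$h_{[s,t+1]}(i)=\sum_{k\in\mathbb Z}w(k)\,h_{[s,t]}(i+k)+\xi_{t+1}(i),\qquad i\in\mathbb Z .$$ The increment process of the harness process is the Markov process on $\mathbb R^{\mathbb Z}$ given by $$\eta_{t+1}(i)=\sum_{k\in\mathbb Z}w(k)\,\eta_t(i+k)+\xi_{t+1}(i)-\xi_{t+1}(i-1),\qquad i\in\mathbb Z,\ t\ge 0,$$ where $\eta_0$ is independent of the noise $\{\xi_t(k)\}_{t\ge 1,k\in\mathbb Z}$. A probability measure $\nu$ on $\mathbb R^{\mathbb Z}$ is called invariant for this process if $\eta_0\sim\nu$ implies $\eta_1\sim\nu$. Write $(\theta_x\eta)(i)=\eta(i+x)$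 for the spatial shifts. **Theorem (Uniqueness).** Let $\nu$ be a probability measure on $\mathbb R^{\mathbb Z}$ that is invariant for the increment process, is invariant under all spatial shifts $\theta_x$, $x\in\mathbb Z$, and is spatially ergodic (every Borel set $B\subseteq\mathbb R^{\mathbb Z}$ with $\theta_xB=B$ for all $x\in\mathbb Z$ has $\nu(B)\in\{0,1\}$). Suppose that $\int|\eta(0)|\,\nu(d\eta)<\infty$ and $\int\eta(0)\,\nu(d\eta)=c$. Then, almost surely, the limits $$\Delta_0(i)=\lim_{s\to\infty}\bigl(h_{[-s,0]}(i)-h_{[-s,0]}(i-1)\bigr),\qquad i\in\mathbb Z,$$ exist, and $\nu=\pi_c$, where $\pi_c$ denotes the law of $\{c+\Delta_0(x)\}_{x\in\mathbb Z}$. -/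

import Mathlib

open MeasureTheory ProbabilityTheory Filter Topology

namespace Harness

/-- The assumptions on the weight vector `w` on `ℤ`. Finiteness of the support is built into
the type `ℤ →₀ ℝ`. -/
structure IsWeight (w : ℤ →₀ ℝ) : Prop where
  nonneg : ∀ k, 0 ≤ w k
  lt_one : ∀ k, w k < 1
  sum_eq_one : ∑ k ∈ w.support, w k = 1
  /-- `w` has span `1`: the largest `d` such that the support lies in a coset `l + d ℤ` is `1`. -/
  span_one :
    IsGreatest {d : ℕ | ∃ l : ℤ, (w.support : Set ℤ) ⊆ {x | ∃ m : ℤ, x = l + (d : ℤ) * m}} 1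

/-- The variables `ξ t k` (time `t ∈ ℤ`, site `k ∈ ℤ`) are i.i.d. with mean zero and finite
variance. -/
structure IsNoise {Ω : Type*} [MeasurableSpace Ω] (P : Measure Ω) (ξ : ℤ → ℤ → Ω → ℝ) : Prop where
  measurable : ∀ t k, Measurable (ξ t k)
  indep : iIndepFun (fun z : ℤ × ℤ => ξ z.1 z.2) P
  identDistrib : ∀ t k, IdentDistrib (ξ t k) (ξ 0 0) P P
  memLp_two : MemLp (ξ 0 0) 2 P
  mean_zero : ∫ ω, ξ 0 0 ω ∂P = 0

/-- One step of the harness process from the height function `h`, with noise `z`. -/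
noncomputable def step (w : ℤ →₀ ℝ) (h z : ℤ → ℝ) : ℤ → ℝ :=
  fun i => ∑ k ∈ w.support, w k * h (i + k) + z i

/-- `heights w z s ς n` is the height function at time `s + n` of the harness process that starts
at time `s` from the configuration `ς` and is driven by the noise realization `z`. -/
noncomputable def heights (w : ℤ →₀ ℝ) (z : ℤ → ℤ → ℝ) (s : ℤ) (ς : ℤ → ℝ) : ℕ → ℤ → ℝ
  | 0 => ς
  | n + 1 => step w (heights w z s ς n) (z (s + n + 1))

/-- The increments of a height function. -/
def increment (h : ℤ → ℝ) : ℤ → ℝ := fun i => h i - h (i - 1)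

/-- One step of the increment process from `η`, with noise `z`. -/
noncomputable def incrementStep (w : ℤ →₀ ℝ) (η z : ℤ → ℝ) : ℤ → ℝ :=
  fun i => ∑ k ∈ w.support, w k * η (i + k) + z i - z (i - 1)

/-- `incrementStep` is the evolution of the increments of the harness process. -/
theorem increment_step (w : ℤ →₀ ℝ) (h z : ℤ → ℝ) :
    increment (step w h z) = incrementStep w (increment h) z := by
  funext i
  have e : ∀ k, i - 1 + k = i + k - 1 := fun k => by ring
  simp only [increment, step, incrementStep, mul_sub, Finset.sum_sub_distrib, e]
  ring

/-- `ν` is invariant for the increment process (in time): if `η₀ ∼ ν` is independent of the noise,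
then `η₁ ∼ ν`. The pair of `η₀` and the noise is realized on the product space
`(ℤ → ℝ) × Ω` with measure `ν ⊗ P`. -/
def IsInvariant {Ω : Type*} [MeasurableSpace Ω] (P : Measure Ω) (w : ℤ →₀ ℝ)
    (ξ : ℤ → ℤ → Ω → ℝ) (ν : Measure (ℤ → ℝ)) : Prop :=
  (ν.prod P).map (fun x : (ℤ → ℝ) × Ω => incrementStep w x.1 (fun k => ξ 1 k x.2)) = ν

/-- The spatial shift `θ_x`. -/
def shift (x : ℤ) (η : ℤ → ℝ) : ℤ → ℝ := fun i => η (i + x)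

/-- `ν` is shift invariant in space. -/
def IsShiftInvariant (ν : Measure (ℤ → ℝ)) : Prop :=
  ∀ (x : ℤ) (A : Set (ℤ → ℝ)), MeasurableSet A → ν (shift x '' A) = ν A

/-- `ν` gives measure `0` or `1` to every Borel set that is invariant under all spatial shifts. -/
def IsSpatiallyErgodic (ν : Measure (ℤ → ℝ)) : Prop :=
  ∀ B : Set (ℤ → ℝ), MeasurableSet B → (∀ x : ℤ, shift x '' B = B) → ν B = 0 ∨ ν B = 1

/-- The increment at site `i` and time `t` of the harness process started from the flat
configuration at time `t - s`. -/
noncomputable def flatIncrement (w : ℤ →₀ ℝ) (z : ℤ → ℤ → ℝ) (t : ℤ) (s : ℕ) (i : ℤ) : ℝ :=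
  increment (heights w z (t - s) (fun _ => 0) s) i

/-- `Δ_t(i)`, the limit of `flatIncrement w z t s i` as `s → ∞`. -/
noncomputable def Delta (w : ℤ →₀ ℝ) (z : ℤ → ℤ → ℝ) (t i : ℤ) : ℝ :=
  limUnder atTop (fun s : ℕ => flatIncrement w z t s i)

/-- `π_c`, the law of `{c + Δ₀(x)}_{x ∈ ℤ}`. -/
noncomputable def piLaw {Ω : Type*} [MeasurableSpace Ω] (P : Measure Ω) (w : ℤ →₀ ℝ)
    (ξ : ℤ → ℤ → Ω → ℝ) (c : ℝ) : Measure (ℤ → ℝ) :=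
  P.map (fun ω x => c + Delta w (fun t k => ξ t k ω) 0 x)

end Harness

namespace Harness

/-! Run the increment process from time `-n` to time `0`, starting from a `ν`-distributed
configuration. By linearity the result is the `n`-fold `w`-average of the initial configuration plus
the flat increment (`evolve_apply`), and by invariance its law is `ν` for every `n`
(`IsInvariant.map_evolve`). The first summand tends to `c` almost surely along a subsequence, the
second to `Delta`. So `ν` is the law of the limit.

Both limits rest on one energy identity (`sum_mul_norm_sub_sq`): averaging by `A = ∑ w k T k` loses
exactly the `w ⊗ w`-mean of `‖T k f - T l f‖ ^ 2`, up to a factor 2. The losses telescope along `A ^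
n f`, and span 1 carries the bound from support differences to the shift by 1. Hence `‖A ^ n (T 1 f
- f)‖ ^ 2` is summable.

On the noise space this bounds the variances of the independent terms whose sum is the flat
increment. On `L²(ν)` it gives decay on coboundaries, which are dense among mean-zero functions by
ergodicity; contraction and approximation extend this to `L¹`. -/

/-- The average `∑ k, w k • T k` of the isometries `T k`. -/
noncomputable def averageMap {V : Type*} [NormedAddCommGroup V] [InnerProductSpace ℝ V]
    (w : ℤ →₀ ℝ) (T : ℤ → V →ₗᵢ[ℝ] V) : V →ₗ[ℝ] V :=
  ∑ k ∈ w.support, w k • (T k).toLinearMap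

/-! ### Averages of a group of isometries of a Hilbert space -/

section Average

variable {V : Type*} [NormedAddCommGroup V] [InnerProductSpace ℝ V]
  {w : ℤ →₀ ℝ} {T : ℤ → V →ₗᵢ[ℝ] V}

lemma averageMap_apply (f : V) : averageMap w T f = ∑ k ∈ w.support, w k • T k f := by
  simp [averageMap]

/-- An additive subgroup of `ℤ` containing all differences of elements of the support of `w`
is everything. -/
lemma IsWeight.one_mem (hw : IsWeight w) (G : AddSubgroup ℤ)
    (hG : ∀ k ∈ w.support, ∀ l ∈ w.support, k - l ∈ G) : (1 : ℤ) ∈ G := by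
  obtain ⟨l, hl⟩ : w.support.Nonempty := by
    rw [Finset.nonempty_iff_ne_empty]
    intro h
    have := hw.sum_eq_one
    simp [h] at this
  obtain ⟨a, ha⟩ := Int.subgroup_cyclic G
  -- A divisor `d` of the generator `a` confines the support to `l + d ℤ`. Used with `d = |a|`, and
  -- with `d = 2` to exclude `a = 0`.
  have hsub : ∀ d : ℕ, (d : ℤ) ∣ a → d ≤ 1 := by
    intro d hd
    refine hw.span_one.2 ⟨l, fun x hx => ?_⟩
    have h := hG x hx l hl
    rw [ha, AddSubgroup.mem_closure_singleton] at h
    obtain ⟨m, hm⟩ := h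
    obtain ⟨q, hq⟩ := hd
    refine ⟨m * q, ?_⟩
    have : x - l = m * a := by simpa using hm.symm
    rw [hq] at this
    linear_combination this
  have h1 : a.natAbs ≤ 1 := hsub _ (Int.natAbs_dvd.2 dvd_rfl)
  have h0 : a ≠ 0 := by
    rintro rfl
    exact absurd (hsub 2 (dvd_zero _)) (by norm_num)
  rw [ha, AddSubgroup.mem_closure_singleton]
  have : a = 1 ∨ a = -1 := by omega
  rcases this with rfl | rfl
  · exact ⟨1, by simp⟩
  · exact ⟨-1, by simp⟩

/-- The loss of energy under averaging. -/
lemma sum_mul_norm_sub_sq (hw : IsWeight w) (f : V) :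
    ∑ k ∈ w.support, ∑ l ∈ w.support, w k * w l * ‖T k f - T l f‖ ^ 2
      = 2 * (‖f‖ ^ 2 - ‖averageMap w T f‖ ^ 2) := by
  have h1 : ∀ k l, w k * w l * ‖T k f - T l f‖ ^ 2
      = 2 * (w k * w l * ‖f‖ ^ 2 - inner ℝ (w k • T k f) (w l • T l f)) := by
    intro k l
    rw [norm_sub_sq_real, (T k).norm_map, (T l).norm_map, real_inner_smul_left,
      real_inner_smul_right]
    ring
  have h2 : ‖averageMap w T f‖ ^ 2
      = ∑ k ∈ w.support, ∑ l ∈ w.support, inner ℝ (w k • T k f) (w l • T l f) := by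
    rw [← real_inner_self_eq_norm_sq, averageMap_apply, sum_inner]
    exact Finset.sum_congr rfl fun k _ => inner_sum _ _ _
  have h3 : ∑ k ∈ w.support, ∑ l ∈ w.support, w k * w l * ‖f‖ ^ 2 = ‖f‖ ^ 2 := by
    simp_rw [← Finset.sum_mul, ← Finset.mul_sum, hw.sum_eq_one, mul_one, hw.sum_eq_one, one_mul]
  rw [h2, ← h3]
  simp_rw [h1, ← Finset.sum_sub_distrib, Finset.mul_sum]

lemma norm_averageMap_le (hw : IsWeight w) (f : V) : ‖averageMap w T f‖ ≤ ‖f‖ := by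
  have h := sum_mul_norm_sub_sq (T := T) hw f
  have h0 : 0 ≤ ∑ k ∈ w.support, ∑ l ∈ w.support, w k * w l * ‖T k f - T l f‖ ^ 2 :=
    Finset.sum_nonneg fun k _ => Finset.sum_nonneg fun l _ =>
      mul_nonneg (mul_nonneg (hw.nonneg k) (hw.nonneg l)) (sq_nonneg _)
  exact le_of_sq_le_sq (by linarith) (norm_nonneg _)

lemma norm_averageMap_pow_le (hw : IsWeight w) (n : ℕ) (f : V) :
    ‖(averageMap w T ^ n) f‖ ≤ ‖f‖ := by
  induction n with
  | zero => simp
  | succ n ih =>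
    rw [pow_succ', Module.End.mul_apply]
    exact (norm_averageMap_le hw _).trans ih

/-- The pair `(k, l)` contributes one nonnegative term to each energy loss, and the losses along the
orbit telescope to at most `2 * ‖f‖ ^ 2`. -/
lemma summable_norm_sub_sq_of_mem (hw : IsWeight w) (f : V) {k l : ℤ} (hk : k ∈ w.support)
    (hl : l ∈ w.support) :
    Summable fun n : ℕ => ‖T k ((averageMap w T ^ n) f) - T l ((averageMap w T ^ n) f)‖ ^ 2 := by
  have hpos : ∀ {j}, j ∈ w.support → 0 < w j := fun {j} hj =>
    lt_of_le_of_ne (hw.nonneg j) (Ne.symm (Finsupp.mem_support_iff.1 hj))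
  have hkl : 0 < w k * w l := mul_pos (hpos hk) (hpos hl)
  refine (summable_mul_left_iff hkl.ne').1 ?_
  refine summable_of_sum_range_le (c := 2 * ‖f‖ ^ 2)
    (fun n => mul_nonneg hkl.le (sq_nonneg _)) fun n => ?_
  have hstep : ∀ g : V, w k * w l * ‖T k g - T l g‖ ^ 2
      ≤ 2 * (‖g‖ ^ 2 - ‖averageMap w T g‖ ^ 2) := by
    intro g
    rw [← sum_mul_norm_sub_sq hw g]
    have hn : ∀ i j, 0 ≤ w i * w j * ‖T i g - T j g‖ ^ 2 := fun i j =>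
      mul_nonneg (mul_nonneg (hw.nonneg i) (hw.nonneg j)) (sq_nonneg _)
    refine le_trans ?_ (Finset.single_le_sum
      (f := fun i => ∑ j ∈ w.support, w i * w j * ‖T i g - T j g‖ ^ 2)
      (fun i _ => Finset.sum_nonneg fun j _ => hn i j) hk)
    exact Finset.single_le_sum (f := fun j => w k * w j * ‖T k g - T j g‖ ^ 2)
      (fun j _ => hn k j) hl
  have htel : ∑ i ∈ Finset.range n, w k * w l *
      ‖T k ((averageMap w T ^ i) f) - T l ((averageMap w T ^ i) f)‖ ^ 2
      ≤ 2 * (‖f‖ ^ 2 - ‖(averageMap w T ^ n) f‖ ^ 2) := by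
    induction n with
    | zero => simp
    | succ n ih =>
      rw [Finset.sum_range_succ, pow_succ' (averageMap w T), Module.End.mul_apply]
      linarith [hstep ((averageMap w T ^ n) f)]
  nlinarith [sq_nonneg ‖(averageMap w T ^ n) f‖]



lemma apply_zero_eq (hT : ∀ a b f, T (a + b) f = T a (T b f))
    (f : V) : T 0 f = f :=
  (T 0).injective (by rw [← hT, add_zero])

lemma apply_averageMap (hT : ∀ a b f, T (a + b) f = T a (T b f))
    (m : ℤ) (f : V) : T m (averageMap w T f) = averageMap w T (T m f) := by
  simp only [averageMap_apply, map_sum, map_smul, ← hT, add_comm m]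

lemma apply_averageMap_pow (hT : ∀ a b f, T (a + b) f = T a (T b f))
    (m : ℤ) (n : ℕ) (f : V) :
    T m ((averageMap w T ^ n) f) = (averageMap w T ^ n) (T m f) := by
  induction n with
  | zero => simp
  | succ n ih =>
    rw [pow_succ', Module.End.mul_apply, Module.End.mul_apply, apply_averageMap hT, ih]

/-- The iterated averages smoothen: the increments of `A ^ n f` are square summable in `n`. -/
theorem summable_norm_averageMap_pow_sq (hT : ∀ a b f, T (a + b) f = T a (T b f))
    (hw : IsWeight w) (f : V) :
    Summable fun n : ℕ => ‖(averageMap w T ^ n) (T 1 f - f)‖ ^ 2 := by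
  -- Square summability passes to sums and negatives of `m` because each `T a` is an isometry; the
  -- span condition then reaches `m = 1`.
  let G : AddSubgroup ℤ :=
    { carrier := {m | Summable fun n : ℕ =>
        ‖T m ((averageMap w T ^ n) f) - (averageMap w T ^ n) f‖ ^ 2}
      zero_mem' := by simp [apply_zero_eq hT, summable_zero]
      add_mem' := by
        intro a b ha hb
        refine Summable.of_nonneg_of_le (fun n => sq_nonneg _) (fun n => ?_)
          ((ha.mul_left 2).add (hb.mul_left 2))
        set g := (averageMap w T ^ n) f
        have e : T (a + b) g - g = (T a g - g) + T a (T b g - g) := by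
          rw [hT, map_sub]; abel
        have h := norm_add_le (T a g - g) (T a (T b g - g))
        rw [(T a).norm_map, ← e] at h
        nlinarith [norm_nonneg (T (a + b) g - g), sq_nonneg (‖T a g - g‖ - ‖T b g - g‖)]
      neg_mem' := by
        intro a ha
        refine ha.congr fun n => ?_
        set g := (averageMap w T ^ n) f
        have e : T a (T (-a) g - g) = -(T a g - g) := by
          rw [map_sub, ← hT, add_neg_cancel, apply_zero_eq hT]; abel
        rw [← (T a).norm_map (T (-a) g - g), e, norm_neg] }
  have h1 : (1 : ℤ) ∈ G := by
    refine hw.one_mem G fun k hk l hl => ?_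
    refine (summable_norm_sub_sq_of_mem (T := T) hw f hk hl).congr fun n => ?_
    set g := (averageMap w T ^ n) f
    have e : T k g - T l g = T l (T (k - l) g - g) := by
      rw [map_sub, ← hT, add_sub_cancel]
    rw [e, (T l).norm_map]
  refine Summable.congr h1 fun n => ?_
  rw [map_sub, apply_averageMap_pow hT]

/-- The iterated averages of a vector tend to `0` on the closure of the coboundaries. -/
theorem tendsto_averageMap_pow_zero [CompleteSpace V] (hT : ∀ a b f, T (a + b) f = T a (T b f))
    (hw : IsWeight w) (f : V)
    (hf : ∀ q : V, T 1 q = q → inner ℝ q f = 0) :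
    Tendsto (fun n : ℕ => (averageMap w T ^ n) f) atTop (𝓝 0) := by
  set K : Submodule ℝ V := LinearMap.range ((T 1).toLinearMap - LinearMap.id) with hK
  have hmem : f ∈ closure (K : Set V) := by
    -- Since the closure of `K` is `Kᗮᗮ`, it suffices that every `q` orthogonal to `K` is fixed by
    -- `T 1`: expand `‖T 1 q - q‖ ^ 2`.
    rw [← Submodule.topologicalClosure_coe, ← Submodule.orthogonal_orthogonal_eq_closure,
      SetLike.mem_coe, Submodule.mem_orthogonal]
    intro q hq
    refine hf q ?_
    rw [Submodule.mem_orthogonal] at hq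
    have h := hq (T 1 q - q) ⟨q, by simp⟩
    rw [inner_sub_left, real_inner_self_eq_norm_sq] at h
    have h2 : ‖T 1 q - q‖ ^ 2 = 0 := by
      rw [norm_sub_sq_real, (T 1).norm_map]; linarith
    exact sub_eq_zero.1 (norm_eq_zero.1 (pow_eq_zero_iff two_ne_zero |>.1 h2))
  rw [Metric.tendsto_atTop]
  intro ε hε
  obtain ⟨g, ⟨v, rfl⟩, hg⟩ := Metric.mem_closure_iff.1 hmem (ε / 2) (by positivity)
  have h0 := (summable_norm_averageMap_pow_sq hT hw v).tendsto_atTop_zero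
  obtain ⟨N, hN⟩ := Metric.tendsto_atTop.1 h0 ((ε / 2) ^ 2) (by positivity)
  refine ⟨N, fun n hn => ?_⟩
  have h1 : ‖(averageMap w T ^ n) (T 1 v - v)‖ < ε / 2 := by
    have := hN n hn
    rw [dist_zero_right, Real.norm_of_nonneg (sq_nonneg _)] at this
    exact lt_of_pow_lt_pow_left₀ 2 (by positivity) this
  rw [dist_zero_right]
  have h2 := norm_averageMap_pow_le (T := T) hw n (f - (T 1 v - v))
  rw [dist_eq_norm] at hg
  simp only [LinearMap.sub_apply, LinearIsometry.coe_toLinearMap, LinearMap.id_apply] at hg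
  calc ‖(averageMap w T ^ n) f‖
      = ‖(averageMap w T ^ n) (f - (T 1 v - v)) + (averageMap w T ^ n) (T 1 v - v)‖ := by
        rw [← map_add, sub_add_cancel]
    _ ≤ _ := norm_add_le _ _
    _ < ε := by linarith

end Average

/-! ### Spatial shifts and ergodicity -/

lemma measurable_shift (x : ℤ) : Measurable (shift x) :=
  measurable_pi_lambda _ fun i => measurable_pi_apply (i + x)

lemma shift_shift (a b : ℤ) (η : ℤ → ℝ) : shift a (shift b η) = shift (b + a) η := by
  funext i
  simp only [shift]
  congr 1
  ring

lemma shift_zero (η : ℤ → ℝ) : shift 0 η = η := by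
  funext i
  simp [shift]

lemma shift_image (x : ℤ) (A : Set (ℤ → ℝ)) : shift x '' A = shift (-x) ⁻¹' A :=
  congrFun (Set.image_eq_preimage_of_inverse
    (fun η => by rw [shift_shift, add_neg_cancel, shift_zero])
    (fun η => by rw [shift_shift, neg_add_cancel, shift_zero])) A

lemma IsShiftInvariant.measurePreserving {ν : Measure (ℤ → ℝ)} (h : IsShiftInvariant ν) (x : ℤ) :
    MeasurePreserving (shift x) ν ν := by
  refine ⟨measurable_shift x, Measure.ext fun A hA => ?_⟩
  rw [Measure.map_apply (measurable_shift x) hA, ← h (-x) A hA, shift_image, neg_neg]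

lemma IsSpatiallyErgodic.ergodic {ν : Measure (ℤ → ℝ)} [IsProbabilityMeasure ν]
    (he : IsSpatiallyErgodic ν) (h : IsShiftInvariant ν) : Ergodic (shift 1) ν := by
  refine ⟨h.measurePreserving 1, ⟨fun s hs hinv => ?_⟩⟩
  have hn : ∀ n : ℕ, shift n ⁻¹' s = s := by
    intro n
    induction n with
    | zero => ext η; simp [shift_zero]
    | succ n ih =>
      nth_rewrite 2 [← ih]
      nth_rewrite 2 [← hinv]
      ext η
      simp only [Set.mem_preimage, shift_shift]
      push_cast
      rfl
  have hall : ∀ x : ℤ, shift x '' s = s := by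
    intro x
    rw [shift_image]
    obtain ⟨n, hx | hx⟩ := Int.eq_nat_or_neg x
    · nth_rewrite 1 [← hn n]
      ext η
      simp [shift_shift, hx, shift_zero]
    · rw [hx, neg_neg, hn]
  rw [Filter.eventuallyConst_set']
  rcases he s hs hall with h0 | h1
  · exact Or.inl (ae_eq_empty.2 h0)
  · exact Or.inr (eventuallyEq_univ.2 ((prob_compl_eq_zero_iff hs).2 h1))

/-! ### Ergodic theorems for iterated averages of observables -/

/-- The averages of an observable over spatial shifts. -/
noncomputable def koopman (w : ℤ →₀ ℝ) (F : (ℤ → ℝ) → ℝ) : (ℤ → ℝ) → ℝ :=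
  fun η => ∑ k ∈ w.support, w k * F (shift k η)

lemma koopman_eq_sum (w : ℤ →₀ ℝ) (F : (ℤ → ℝ) → ℝ) :
    koopman w F = ∑ k ∈ w.support, w k • (F ∘ shift k) := by
  funext η
  simp [koopman]

lemma koopman_add (w : ℤ →₀ ℝ) (F G : (ℤ → ℝ) → ℝ) :
    koopman w (F + G) = koopman w F + koopman w G := by
  funext η
  simp [koopman, mul_add, Finset.sum_add_distrib]

lemma koopman_iterate_add (w : ℤ →₀ ℝ) (n : ℕ) (F G : (ℤ → ℝ) → ℝ) :
    (koopman w)^[n] (F + G) = (koopman w)^[n] F + (koopman w)^[n] G := by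
  induction n generalizing F G with
  | zero => rfl
  | succ n ih => simp only [Function.iterate_succ_apply, koopman_add, ih]

lemma IsWeight.koopman_iterate_const {w : ℤ →₀ ℝ} (hw : IsWeight w) (n : ℕ) (c : ℝ) :
    (koopman w)^[n] (fun _ => c) = fun _ => c := by
  refine Function.iterate_fixed ?_ n
  funext η
  simp [koopman, ← Finset.sum_mul, hw.sum_eq_one]

lemma measurable_koopman_iterate {w : ℤ →₀ ℝ} {F : (ℤ → ℝ) → ℝ} (hF : Measurable F) (n : ℕ) :
    Measurable ((koopman w)^[n] F) := by
  induction n with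
  | zero => exact hF
  | succ n ih =>
    rw [Function.iterate_succ_apply']
    exact Finset.measurable_fun_sum _ fun k _ => (ih.comp (measurable_shift k)).const_mul (w k)

section Lp

variable {μ : Measure (ℤ → ℝ)} {w : ℤ →₀ ℝ} {F : (ℤ → ℝ) → ℝ} {p : ENNReal}

lemma memLp_koopman (hμ : ∀ k, MeasurePreserving (shift k) μ μ) (hF : MemLp F p μ) :
    MemLp (koopman w F) p μ := by
  rw [koopman_eq_sum]
  exact memLp_finsetSum' _ fun k _ => (hF.comp_measurePreserving (hμ k)).const_smul _

lemma memLp_koopman_iterate (hμ : ∀ k, MeasurePreserving (shift k) μ μ) (hF : MemLp F p μ)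
    (n : ℕ) : MemLp ((koopman w)^[n] F) p μ := by
  induction n with
  | zero => exact hF
  | succ n ih =>
    rw [Function.iterate_succ_apply']
    exact memLp_koopman hμ ih

/-- Minkowski's inequality for a convex combination of norm-preserving shifts. The case `p = 1`
controls the approximation error in the `L¹` ergodic theorem. -/
lemma eLpNorm_koopman_iterate_le (hw : IsWeight w) (hμ : ∀ k, MeasurePreserving (shift k) μ μ)
    (hp : 1 ≤ p) (hF : MemLp F p μ) (n : ℕ) :
    eLpNorm ((koopman w)^[n] F) p μ ≤ eLpNorm F p μ := by
  induction n with
  | zero => exact le_rfl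
  | succ n ih =>
    refine le_trans ?_ ih
    have hG := memLp_koopman_iterate (w := w) hμ hF n
    rw [Function.iterate_succ_apply']
    set G := (koopman w)^[n] F
    rw [koopman_eq_sum]
    refine (eLpNorm_sum_le (fun k _ =>
      ((hG.comp_measurePreserving (hμ k)).const_smul (w k)).aestronglyMeasurable) hp).trans ?_
    have h1 : ∀ k ∈ w.support, eLpNorm (w k • (G ∘ shift k)) p μ
        = ENNReal.ofReal (w k) * eLpNorm G p μ := by
      intro k _
      rw [eLpNorm_const_smul, eLpNorm_comp_measurePreserving hG.aestronglyMeasurable (hμ k),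
        Real.enorm_of_nonneg (hw.nonneg k)]
    rw [Finset.sum_congr rfl h1, ← Finset.sum_mul, ← ENNReal.ofReal_sum_of_nonneg
      fun k _ => hw.nonneg k, hw.sum_eq_one, ENNReal.ofReal_one, one_mul]

/-- The action of the spatial shifts on `L²`. -/
noncomputable def shiftLp (hμ : ∀ k, MeasurePreserving (shift k) μ μ) (k : ℤ) :
    Lp ℝ 2 μ →ₗᵢ[ℝ] Lp ℝ 2 μ :=
  Lp.compMeasurePreservingₗᵢ ℝ (shift k) (hμ k)

lemma shiftLp_toLp (hμ : ∀ k, MeasurePreserving (shift k) μ μ) (hF : MemLp F 2 μ) (k : ℤ) :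
    shiftLp hμ k (hF.toLp F) = (hF.comp_measurePreserving (hμ k)).toLp (F ∘ shift k) :=
  Lp.toLp_compMeasurePreserving hF (hμ k)

lemma shiftLp_add (hμ : ∀ k, MeasurePreserving (shift k) μ μ) (a b : ℤ) (f : Lp ℝ 2 μ) :
    shiftLp hμ (a + b) f = shiftLp hμ a (shiftLp hμ b f) := by
  rw [← Lp.toLp_coeFn f (Lp.memLp f), shiftLp_toLp, shiftLp_toLp, shiftLp_toLp]
  congr 1
  funext η
  simp only [Function.comp, shift_shift]

/-- Transfers the Hilbert space results to averages of genuine functions, which the pathwise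
decomposition requires. -/
lemma averageMap_pow_toLp (hμ : ∀ k, MeasurePreserving (shift k) μ μ) (hF : MemLp F 2 μ) (n : ℕ) :
    (averageMap w (shiftLp hμ) ^ n) (hF.toLp F)
      = (memLp_koopman_iterate hμ hF n).toLp ((koopman w)^[n] F) := by
  induction n with
  | zero => simp
  | succ n ih =>
    have hG := memLp_koopman_iterate (w := w) hμ hF n
    rw [pow_succ', Module.End.mul_apply, ih, averageMap_apply]
    simp only [shiftLp_toLp, ← MemLp.toLp_const_smul, Function.iterate_succ_apply']
    rw [Lp.ext_iff]
    refine (Lp.coeFn_finsetSum _ _).trans ?_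
    refine EventuallyEq.trans ?_ (MemLp.coeFn_toLp _).symm
    have h1 : ∀ᵐ η ∂μ, ∀ k : ℤ, ((hG.comp_measurePreserving (hμ k)).const_smul (w k)).toLp
        (w k • ((koopman w)^[n] F ∘ shift k)) η = (w k • ((koopman w)^[n] F ∘ shift k)) η :=
      ae_all_iff.2 fun k => MemLp.coeFn_toLp _
    filter_upwards [h1] with η h
    simp only [Finset.sum_apply, h, koopman_eq_sum]

/-- The increments of the iterated averages are square summable. -/
theorem summable_integral_koopman_iterate_sq (hw : IsWeight w)
    (hμ : ∀ k, MeasurePreserving (shift k) μ μ) (hF : MemLp F 2 μ) :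
    Summable fun n : ℕ => ∫ η, ((koopman w)^[n] (F ∘ shift 1 - F) η) ^ 2 ∂μ := by
  refine (summable_norm_averageMap_pow_sq (shiftLp_add hμ) hw (hF.toLp F)).congr fun n => ?_
  have hG : MemLp (F ∘ shift 1 - F) 2 μ := (hF.comp_measurePreserving (hμ 1)).sub hF
  rw [shiftLp_toLp, ← MemLp.toLp_sub, averageMap_pow_toLp hμ hG, ← real_inner_self_eq_norm_sq,
    L2.inner_def]
  refine integral_congr_ae ?_
  filter_upwards [MemLp.coeFn_toLp (memLp_koopman_iterate (w := w) hμ hG n)] with η h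
  rw [h]
  simp [sq]

/-- An `L²` ergodic theorem for the iterated averages. -/
theorem tendsto_eLpNorm_two_koopman_iterate [IsProbabilityMeasure μ] (hw : IsWeight w)
    (hμ : ∀ k, MeasurePreserving (shift k) μ μ) (he : Ergodic (shift 1) μ)
    (hF : MemLp F 2 μ) (h0 : ∫ η, F η ∂μ = 0) :
    Tendsto (fun n : ℕ => eLpNorm ((koopman w)^[n] F) 2 μ) atTop (𝓝 0) := by
  have key := tendsto_averageMap_pow_zero (w := w) (shiftLp_add hμ) hw (hF.toLp F) (fun q hq => ?_)
  · simp only [averageMap_pow_toLp hμ hF] at key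
    have h1 := (Lp.tendsto_Lp_iff_tendsto_eLpNorm' _ _).1 key
    refine h1.congr fun n => eLpNorm_congr_ae ?_
    filter_upwards [MemLp.coeFn_toLp (memLp_koopman_iterate (w := w) hμ hF n)] with η h
    simp [h]
  -- Ergodicity makes a fixed vector constant, hence orthogonal to the mean-zero `F`.
  · obtain ⟨d, hd⟩ := he.ae_eq_const_of_ae_eq_comp_ae (Lp.aestronglyMeasurable q)
      (show q ∘ shift 1 =ᵐ[μ] q by
        have := Lp.coeFn_compMeasurePreserving q (hμ 1)
        have h2 : Lp.compMeasurePreserving (shift 1) (hμ 1) q = q := hq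
        rw [h2] at this
        exact this.symm)
    rw [L2.inner_def]
    have : (fun η => inner ℝ (q η) (hF.toLp F η)) =ᵐ[μ] fun η => d * F η := by
      filter_upwards [hd, hF.coeFn_toLp] with η h1 h2
      rw [h1, h2]
      simp [mul_comm]
    rw [integral_congr_ae this, integral_const_mul, h0, mul_zero]

/-- An `L¹` ergodic theorem for the iterated averages. -/
theorem tendsto_eLpNorm_one_koopman_iterate [IsProbabilityMeasure μ] (hw : IsWeight w)
    (hμ : ∀ k, MeasurePreserving (shift k) μ μ) (he : Ergodic (shift 1) μ)
    (hF : Integrable F μ) (h0 : ∫ η, F η ∂μ = 0) :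
    Tendsto (fun n : ℕ => eLpNorm ((koopman w)^[n] F) 1 μ) atTop (𝓝 0) := by
  rw [ENNReal.tendsto_atTop_zero]
  intro ε hε
  have hε3 : ε / 3 ≠ 0 := by simpa using hε.ne'
  -- One third of `ε` each for the error `F - G`, the centred `G` (by the `L²` theorem) and the mean
  -- `d` of `G`, which is small because `F` has mean zero.
  obtain ⟨G, hG, -⟩ := (memLp_one_iff_integrable.2 hF).exists_simpleFunc_eLpNorm_sub_lt
    ENNReal.one_ne_top hε3
  have hG2 : MemLp (G : (ℤ → ℝ) → ℝ) 2 μ := G.memLp_of_isFiniteMeasure 2 μ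
  have hG1 : Integrable (G : (ℤ → ℝ) → ℝ) μ := hG2.integrable (by norm_num)
  set d := ∫ η, G η ∂μ with hd
  have hGd : MemLp (fun η => G η - d) 2 μ := hG2.sub (memLp_const d)
  have hGd0 : ∫ η, (G η - d) ∂μ = 0 := by
    rw [integral_sub hG1 (integrable_const d)]
    simp [hd]
  have hFG : MemLp (F - ⇑G) 1 μ := memLp_one_iff_integrable.2 (hF.sub hG1)
  have hdle : ‖d‖ₑ ≤ ε / 3 := by
    have : d = -∫ η, (F - ⇑G) η ∂μ := by
      simp only [Pi.sub_apply]
      rw [integral_sub hF hG1, h0, hd]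
      ring
    rw [this, enorm_neg]
    refine (enorm_integral_le_lintegral_enorm _).trans ?_
    rw [← eLpNorm_one_eq_lintegral_enorm]
    exact hG.le
  obtain ⟨N, hN⟩ := ENNReal.tendsto_atTop_zero.1
    (tendsto_eLpNorm_two_koopman_iterate hw hμ he hGd hGd0) (ε / 3) (pos_iff_ne_zero.2 hε3)
  refine ⟨N, fun n hn => ?_⟩
  have hdec : F = (F - ⇑G) + ((fun η => G η - d) + fun _ => d) := by
    funext η
    simp
  have h1 := eLpNorm_koopman_iterate_le hw hμ le_rfl hFG n
  have hm2 := memLp_koopman_iterate (w := w) hμ hGd n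
  have h2 : eLpNorm ((koopman w)^[n] fun η => G η - d) 1 μ ≤ ε / 3 :=
    (eLpNorm_le_eLpNorm_of_exponent_le (by norm_num) hm2.aestronglyMeasurable).trans (hN n hn)
  have h3 : eLpNorm (fun _ : ℤ → ℝ => d) 1 μ ≤ ε / 3 := by
    rw [eLpNorm_one_eq_lintegral_enorm]
    simpa using hdle
  rw [hdec, koopman_iterate_add, koopman_iterate_add, hw.koopman_iterate_const]
  have hm1 := (memLp_koopman_iterate (w := w) hμ hFG n).aestronglyMeasurable
  calc _ ≤ _ := eLpNorm_add_le hm1 (hm2.aestronglyMeasurable.add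
        aestronglyMeasurable_const) le_rfl
    _ ≤ ε / 3 + (ε / 3 + ε / 3) := add_le_add (h1.trans hG.le)
        ((eLpNorm_add_le hm2.aestronglyMeasurable aestronglyMeasurable_const le_rfl).trans
          (add_le_add h2 h3))
    _ = ε := by rw [← add_assoc, ENNReal.add_thirds]

end Lp

/-! ### Pathwise decomposition of the evolution -/

/-- `evolve w z s η n` is the increment process at time `s + n`, started from `η` at time `s` and
driven by the noise realization `z`. -/
noncomputable def evolve (w : ℤ →₀ ℝ) (z : ℤ → ℤ → ℝ) (s : ℤ) (η : ℤ → ℝ) : ℕ → ℤ → ℝ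
  | 0 => η
  | n + 1 => incrementStep w (evolve w z s η n) (z (s + n + 1))

section Deterministic

variable (w : ℤ →₀ ℝ) (z : ℤ → ℤ → ℝ)

lemma increment_heights (s : ℤ) (ς : ℤ → ℝ) (n : ℕ) :
    increment (heights w z s ς n) = evolve w z s (increment ς) n := by
  induction n with
  | zero => rfl
  | succ n ih => rw [heights, evolve, increment_step, ih]

lemma flatIncrement_eq_evolve (n : ℕ) (i : ℤ) :
    flatIncrement w z 0 n i = evolve w z (-n) 0 n i := by
  rw [flatIncrement, increment_heights, zero_sub]
  congr
  funext i
  simp [increment]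

/-- Peels off the first step instead of the last, so that different starting times can be compared.
-/
lemma evolve_succ' (s : ℤ) (η : ℤ → ℝ) (n : ℕ) :
    evolve w z s η (n + 1) = evolve w z (s + 1) (incrementStep w η (z (s + 1))) n := by
  induction n with
  | zero => simp [evolve]
  | succ n ih =>
    rw [evolve, ih, evolve]
    congr 2
    push_cast
    ring

lemma koopman_iterate_comp (n : ℕ) (F : (ℤ → ℝ) → ℝ) (S : (ℤ → ℝ) → (ℤ → ℝ))
    (hS : ∀ k η, S (shift k η) = shift k (S η)) (η : ℤ → ℝ) :
    (koopman w)^[n] F (S η) = (koopman w)^[n] (F ∘ S) η := by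
  induction n generalizing η with
  | zero => rfl
  | succ n ih => simp only [Function.iterate_succ_apply', koopman, ← ih, hS]

lemma koopman_iterate_eval_shift (n : ℕ) (i k : ℤ) (η : ℤ → ℝ) :
    (koopman w)^[n] (fun η => η i) (shift k η) = (koopman w)^[n] (fun η => η (i + k)) η := by
  rw [koopman_iterate_comp w n _ (shift k) fun l η => by
    rw [shift_shift, shift_shift, add_comm]]
  rfl

/-- The influence of the initial configuration and that of the noise add up. -/
lemma evolve_apply (s : ℤ) (η : ℤ → ℝ) (n : ℕ) (i : ℤ) :
    evolve w z s η n i = (koopman w)^[n] (fun η => η i) η + evolve w z s 0 n i := by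
  induction n generalizing i with
  | zero => simp [evolve]
  | succ n ih =>
    simp only [evolve, incrementStep]
    simp only [ih, Function.iterate_succ_apply', koopman, koopman_iterate_eval_shift, mul_add,
      Finset.sum_add_distrib]
    ring

/-- Starting one step earlier replaces the zero configuration at time `-n` by the increments of the
noise at time `-n`. Each new term thus uses a fresh noise row, and it is an average of a coboundary.
-/
lemma flatIncrement_succ (n : ℕ) (i : ℤ) :
    flatIncrement w z 0 (n + 1) i = flatIncrement w z 0 n i
      + (koopman w)^[n] ((fun η => η (i - 1)) ∘ shift 1 - fun η => η (i - 1)) (z (-n)) := by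
  have h0 : incrementStep w 0 (z (-n)) = increment (z (-n)) := by
    funext i
    simp [incrementStep, increment]
  have h1 : (-((n + 1 : ℕ) : ℤ)) + 1 = -n := by push_cast; ring
  rw [flatIncrement_eq_evolve, flatIncrement_eq_evolve, evolve_succ', h1, h0, evolve_apply,
    koopman_iterate_comp w n _ increment, add_comm]
  · have e : (fun η : ℤ → ℝ => η i) ∘ increment
        = (fun η => η (i - 1)) ∘ shift 1 - fun η => η (i - 1) := by
      funext η
      simp [increment, shift]
    rw [e]
  · intro k η
    funext i
    simp only [increment, shift]
    congr 2
    ring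

lemma flatIncrement_eq_sum (n : ℕ) (i : ℤ) :
    flatIncrement w z 0 n i = ∑ s ∈ Finset.range n,
      (koopman w)^[s] ((fun η => η (i - 1)) ∘ shift 1 - fun η => η (i - 1)) (z (-s)) := by
  induction n with
  | zero => simp [flatIncrement, heights, increment]
  | succ n ih => rw [flatIncrement_succ, Finset.sum_range_succ, ih]

end Deterministic

lemma integrable_comp_shift {μ : Measure (ℤ → ℝ)} {k : ℤ} (hμ : MeasurePreserving (shift k) μ μ)
    {F : (ℤ → ℝ) → ℝ} (hF : Integrable F μ) : Integrable (fun η => F (shift k η)) μ :=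
  hμ.integrable_comp_of_integrable hF

lemma integral_comp_shift {μ : Measure (ℤ → ℝ)} {k : ℤ} (hμ : MeasurePreserving (shift k) μ μ)
    {F : (ℤ → ℝ) → ℝ} (hF : Integrable F μ) : ∫ η, F (shift k η) ∂μ = ∫ η, F η ∂μ := by
  conv_rhs => rw [← hμ.map_eq]
  rw [integral_map hμ.measurable.aemeasurable (by rw [hμ.map_eq]; exact hF.aestronglyMeasurable)]

lemma integral_koopman_iterate {μ : Measure (ℤ → ℝ)} {w : ℤ →₀ ℝ} (hw : IsWeight w)
    (hμ : ∀ k, MeasurePreserving (shift k) μ μ) {F : (ℤ → ℝ) → ℝ} (hF : Integrable F μ) (n : ℕ) :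
    ∫ η, (koopman w)^[n] F η ∂μ = ∫ η, F η ∂μ := by
  induction n with
  | zero => rfl
  | succ n ih =>
    have hG : Integrable ((koopman w)^[n] F) μ :=
      memLp_one_iff_integrable.1 (memLp_koopman_iterate hμ (memLp_one_iff_integrable.2 hF) n)
    rw [Function.iterate_succ_apply', ← ih]
    simp only [koopman]
    rw [integral_finsetSum _ fun k _ => (integrable_comp_shift (hμ k) hG).const_mul (w k)]
    simp only [integral_const_mul, integral_comp_shift (hμ _) hG]
    rw [← Finset.sum_mul, hw.sum_eq_one, one_mul]

/-! ### The law and independence of the noise rows -/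

section Noise

variable {Ω : Type*} [MeasurableSpace Ω] {P : Measure Ω} {ξ : ℤ → ℤ → Ω → ℝ}

/-- The law of the noise at a fixed time. -/
noncomputable def rowLaw (P : Measure Ω) (ξ : ℤ → ℤ → Ω → ℝ) : Measure (ℤ → ℝ) :=
  P.map fun ω k => ξ 0 k ω

lemma IsNoise.measurable_row (hξ : IsNoise P ξ) (t : ℤ) : Measurable fun ω k => ξ t k ω :=
  measurable_pi_lambda _ fun k => hξ.measurable t k

lemma IsNoise.memLp_eval (hξ : IsNoise P ξ) (i : ℤ) :
    MemLp (fun η : ℤ → ℝ => η i) 2 (rowLaw P ξ) := by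
  have h : MemLp (ξ 0 i) 2 P := (hξ.identDistrib 0 i).symm.memLp_snd hξ.memLp_two
  refine (memLp_map_measure_iff (measurable_pi_apply i).aestronglyMeasurable
    (hξ.measurable_row 0).aemeasurable).2 h

variable [IsProbabilityMeasure P]

lemma IsNoise.map_row_shift (hξ : IsNoise P ξ) (t x : ℤ) :
    P.map (fun ω k => ξ t (k + x) ω) = rowLaw P ξ := by
  have h : ∀ t x : ℤ, P.map (fun ω k => ξ t (k + x) ω)
      = Measure.infinitePi fun _ : ℤ => P.map (ξ 0 0) := by
    intro t x
    have hinj : Function.Injective fun k : ℤ => (t, k + x) := fun a b hab => by simpa using hab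
    rw [(iIndepFun_iff_map_fun_eq_infinitePi_map fun k => hξ.measurable t (k + x)).1
      (hξ.indep.precomp hinj)]
    simp only [(hξ.identDistrib _ _).map_eq]
  rw [h, rowLaw, ← h 0 0]
  simp

lemma IsNoise.map_row (hξ : IsNoise P ξ) (t : ℤ) : P.map (fun ω k => ξ t k ω) = rowLaw P ξ := by
  simpa using hξ.map_row_shift t 0

lemma IsNoise.measurePreserving_row (hξ : IsNoise P ξ) (t : ℤ) :
    MeasurePreserving (fun ω k => ξ t k ω) P (rowLaw P ξ) :=
  ⟨hξ.measurable_row t, hξ.map_row t⟩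

lemma IsNoise.measurePreserving_shift (hξ : IsNoise P ξ) (x : ℤ) :
    MeasurePreserving (shift x) (rowLaw P ξ) (rowLaw P ξ) := by
  refine ⟨measurable_shift x, ?_⟩
  nth_rewrite 1 [rowLaw]
  rw [Measure.map_map (measurable_shift x) (hξ.measurable_row 0)]
  exact hξ.map_row_shift 0 x

/-- The noises at different times are independent. -/
lemma IsNoise.iIndepFun_row (hξ : IsNoise P ξ) :
    iIndepFun (fun (t : ℤ) ω (k : ℤ) => ξ t k ω) P := by
  have hprob : ∀ t k, IsProbabilityMeasure (P.map (ξ t k)) :=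
    fun t k => Measure.isProbabilityMeasure_map (hξ.measurable t k).aemeasurable
  have hpair := (iIndepFun_iff_map_fun_eq_infinitePi_map
    (fun z : ℤ × ℤ => hξ.measurable z.1 z.2)).1 hξ.indep
  rw [iIndepFun_iff_map_fun_eq_infinitePi_map hξ.measurable_row]
  have hrow : ∀ t, P.map (fun ω k => ξ t k ω) = Measure.infinitePi fun k => P.map (ξ t k) :=
    fun t => (iIndepFun_iff_map_fun_eq_infinitePi_map (hξ.measurable t)).1
      (hξ.indep.precomp (g := fun k : ℤ => (t, k)) fun a b hab => by simpa using hab)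
  simp only [hrow]
  -- Currying identifies the product law over `ℤ × ℤ` with the product of the row laws.
  rw [← Measure.infinitePi_map_curry (fun t k => P.map (ξ t k)), ← hpair]
  exact (Measure.map_map (MeasurableEquiv.curry ℤ ℤ ℝ).measurable
    (measurable_pi_lambda _ fun z : ℤ × ℤ => hξ.measurable z.1 z.2)).symm

end Noise

/-! ### Almost sure convergence of the flat increments -/

/-- A series of independent centered random variables with summable second moments converges
almost surely. -/
theorem exists_ae_tendsto_sum_of_summable_integral_sq {Ω : Type*} [MeasurableSpace Ω]
    {P : Measure Ω} [IsProbabilityMeasure P] {X : ℕ → Ω → ℝ} (hm : ∀ n, Measurable (X n))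
    (hX : ∀ n, MemLp (X n) 2 P) (hind : iIndepFun X P) (h0 : ∀ n, ∫ ω, X n ω ∂P = 0)
    (hsum : Summable fun n => ∫ ω, X n ω ^ 2 ∂P) :
    ∀ᵐ ω ∂P, ∃ a, Tendsto (fun n => ∑ s ∈ Finset.range n, X s ω) atTop (𝓝 a) := by
  have hsm : ∀ n, StronglyMeasurable (X n) := fun n => (hm n).stronglyMeasurable
  have hint : ∀ n, Integrable (X n) P := fun n => (hX n).integrable (by norm_num)
  -- Summing through index `n` adapts `S n` to the natural filtration at `n`; `S` is then an
  -- `L²`-bounded martingale.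
  set S : ℕ → Ω → ℝ := fun n => ∑ s ∈ Finset.range (n + 1), X s with hS
  have hSm : ∀ n, MemLp (S n) 2 P := fun n => memLp_finsetSum' _ fun s _ => hX s
  have hmart : Martingale S (Filtration.natural X hsm) P := by
    refine martingale_of_condExp_sub_eq_zero_nat ?_
      (fun n => (hSm n).integrable (by norm_num)) fun n => ?_
    · intro n
      refine Finset.stronglyMeasurable_sum _ fun s hs => ?_
      exact ((Filtration.stronglyAdapted_natural hsm) s).mono
        ((Filtration.natural X hsm).mono (Nat.lt_succ_iff.1 (Finset.mem_range.1 hs)))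
    · have e : S (n + 1) - S n = X (n + 1) := by
        simp [hS, Finset.sum_range_succ _ (n + 1)]
      rw [e]
      refine (hind.condExp_natural_ae_eq_of_lt hsm n.lt_succ_self).trans ?_
      rw [h0]
      rfl
  have hbdd : ∀ n, eLpNorm (S n) 1 P
      ≤ ((Real.toNNReal (Real.sqrt (∑' n, ∫ ω, X n ω ^ 2 ∂P)) : NNReal) : ENNReal) := by
    intro n
    refine (eLpNorm_le_eLpNorm_of_exponent_le (by norm_num : (1 : ENNReal) ≤ 2)
      (hSm n).aestronglyMeasurable).trans ?_
    have hmean : ∫ ω, S n ω ∂P = 0 := by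
      simp only [hS, Finset.sum_apply]
      rw [integral_finsetSum _ fun s _ => hint s]
      simp [h0]
    have hvar : ∫ ω, S n ω ^ 2 ∂P = ∑ s ∈ Finset.range (n + 1), ∫ ω, X s ω ^ 2 ∂P := by
      rw [← variance_of_integral_eq_zero (hSm n).aemeasurable hmean,
        IndepFun.variance_sum (fun s _ => hX s) fun i _ j _ hij => hind.indepFun hij]
      exact Finset.sum_congr rfl fun s _ =>
        variance_of_integral_eq_zero (hX s).aemeasurable (h0 s)
    rw [(hSm n).eLpNorm_eq_integral_rpow_norm two_ne_zero ENNReal.ofNat_ne_top]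
    have e2 : ∫ ω, ‖S n ω‖ ^ (2 : ENNReal).toReal ∂P = ∫ ω, S n ω ^ 2 ∂P := by
      simp
    rw [e2, hvar]
    refine ENNReal.ofReal_le_ofReal ?_
    rw [Real.sqrt_eq_rpow]
    simp only [ENNReal.toReal_ofNat, one_div]
    refine Real.rpow_le_rpow (Finset.sum_nonneg fun s _ => integral_nonneg fun ω => sq_nonneg _)
      (hsum.sum_le_tsum _ fun s _ => integral_nonneg fun ω => sq_nonneg _) (by norm_num)
  filter_upwards [hmart.submartingale.exists_ae_tendsto_of_bdd hbdd] with ω ⟨a, ha⟩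
  refine ⟨a, (tendsto_add_atTop_iff_nat 1).1 (ha.congr fun n => ?_)⟩
  simp [hS]

/-- The flat increments converge almost surely. -/
theorem IsNoise.ae_tendsto_flatIncrement {Ω : Type*} [MeasurableSpace Ω] {P : Measure Ω}
    [IsProbabilityMeasure P] {ξ : ℤ → ℤ → Ω → ℝ} (hξ : IsNoise P ξ) {w : ℤ →₀ ℝ}
    (hw : IsWeight w) :
    ∀ᵐ ω ∂P, ∀ i : ℤ, Tendsto (fun s : ℕ => flatIncrement w (fun t k => ξ t k ω) 0 s i)
      atTop (𝓝 (Delta w (fun t k => ξ t k ω) 0 i)) := by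
  refine ae_all_iff.2 fun i => ?_
  set F : (ℤ → ℝ) → ℝ := (fun η => η (i - 1)) ∘ shift 1 - fun η => η (i - 1) with hF
  have hFm : Measurable F :=
    ((measurable_pi_apply (i - 1)).comp (measurable_shift 1)).sub (measurable_pi_apply (i - 1))
  have he := hξ.memLp_eval (i - 1)
  have hμ := hξ.measurePreserving_shift
  have hF2 : MemLp F 2 (rowLaw P ξ) := (he.comp_measurePreserving (hμ 1)).sub he
  have : IsProbabilityMeasure (rowLaw P ξ) :=
    Measure.isProbabilityMeasure_map (hξ.measurable_row 0).aemeasurable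
  have he1 := he.integrable (by norm_num)
  have hF1 : Integrable F (rowLaw P ξ) := hF2.integrable (by norm_num)
  have hF0 : ∫ η, F η ∂(rowLaw P ξ) = 0 := by
    simp only [hF, Pi.sub_apply, Function.comp]
    rw [integral_sub (integrable_comp_shift (hμ 1) he1) he1,
      integral_comp_shift (hμ 1) he1, sub_self]
  have hGm : ∀ n, Measurable ((koopman w)^[n] F) := measurable_koopman_iterate hFm
  have hmap : ∀ (G : (ℤ → ℝ) → ℝ), Measurable G → ∀ t,
      ∫ ω, G (fun k => ξ t k ω) ∂P = ∫ η, G η ∂(rowLaw P ξ) := by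
    intro G hG t
    rw [← hξ.map_row t, integral_map (hξ.measurable_row t).aemeasurable hG.aestronglyMeasurable]
  have key := exists_ae_tendsto_sum_of_summable_integral_sq (P := P)
    (X := fun n ω => (koopman w)^[n] F (fun k => ξ (-n) k ω))
    (fun n => (hGm n).comp (hξ.measurable_row _))
    (fun n => (memLp_koopman_iterate hμ hF2 n).comp_measurePreserving
      (hξ.measurePreserving_row _)) ?_ ?_ ?_
  · filter_upwards [key] with ω hω
    simp only [← flatIncrement_eq_sum w (fun t k => ξ t k ω), hF] at hω
    exact tendsto_nhds_limUnder hω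
  · have hinj : Function.Injective fun n : ℕ => -(n : ℤ) := fun a b hab => by simpa using hab
    exact (hξ.iIndepFun_row.precomp hinj).comp _ fun n => hGm n
  · intro n
    rw [hmap _ (hGm n), integral_koopman_iterate hw hμ hF1, hF0]
  · refine (summable_integral_koopman_iterate_sq hw hμ he).congr fun n => ?_
    exact (hmap _ ((hGm n).pow_const 2) _).symm

/-! ### Preservation of the invariant law -/

lemma measurable_incrementStep {α : Type*} [MeasurableSpace α] (w : ℤ →₀ ℝ) {X Z : α → ℤ → ℝ}
    (hX : Measurable X) (hZ : Measurable Z) : Measurable fun a => incrementStep w (X a) (Z a) := by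
  refine measurable_pi_lambda _ fun i => ?_
  simp only [incrementStep]
  have hX' : ∀ j, Measurable fun a => X a j := fun j => (measurable_pi_apply j).comp hX
  have hZ' : ∀ j, Measurable fun a => Z a j := fun j => (measurable_pi_apply j).comp hZ
  exact ((Finset.measurable_fun_sum _ fun k _ => (hX' (i + k)).const_mul (w k)).add
    (hZ' i)).sub (hZ' (i - 1))

/-- The evolution up to time `s + n` only uses the noise up to time `s + n`. -/
lemma measurable_evolve {α : Type*} [MeasurableSpace α] (w : ℤ →₀ ℝ) {X : α → ℤ → ℝ}
    {Z : ℤ → α → ℤ → ℝ} (s : ℤ) (n : ℕ) (hX : Measurable X)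
    (hZ : ∀ t ≤ s + n, Measurable (Z t)) :
    Measurable fun a => evolve w (fun t k => Z t a k) s (X a) n := by
  induction n with
  | zero => exact hX
  | succ n ih =>
    refine measurable_incrementStep w (ih fun t ht => hZ t (by push_cast; omega)) ?_
    exact hZ _ (by push_cast; omega)

section Law

variable {Ω : Type*} [MeasurableSpace Ω] {P : Measure Ω} [IsProbabilityMeasure P]
  {ξ : ℤ → ℤ → Ω → ℝ} {w : ℤ →₀ ℝ} {ν : Measure (ℤ → ℝ)} [IsProbabilityMeasure ν]

/-- The state at time `s + n` is measurable for the rows up to that time, which are independent of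
the next one. A fixed `η` suffices, since Fubini restores the random start. -/
lemma IsNoise.indepFun_evolve (hξ : IsNoise P ξ) (s : ℤ) (n : ℕ) (η : ℤ → ℝ) :
    IndepFun (fun ω => evolve w (fun t k => ξ t k ω) s η n) (fun ω k => ξ (s + n + 1) k ω) P := by
  have hle : ∀ t : ℤ, MeasurableSpace.comap (fun ω k => ξ t k ω) inferInstance ≤
      (inferInstance : MeasurableSpace Ω) := fun t => (hξ.measurable_row t).comap_le
  have h := indep_iSup_of_disjoint (S := {t | t ≤ s + n}) (T := {s + n + 1}) hle hξ.iIndepFun_row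
    (by simp)
  rw [iSup_singleton] at h
  refine indep_of_indep_of_le_left h ?_
  refine Measurable.comap_le ?_
  refine @measurable_evolve Ω (⨆ t ∈ {t | t ≤ s + n},
    MeasurableSpace.comap (fun ω k => ξ t k ω) inferInstance) w (fun _ => η)
    (fun t ω k => ξ t k ω) s n (@measurable_const _ _ _ _ _) fun t ht => ?_
  exact (comap_measurable _).mono (le_biSup (fun t => MeasurableSpace.comap
    (fun ω k => ξ t k ω) inferInstance) ht) le_rfl

/-- An invariant law is preserved by the evolution. -/
theorem IsInvariant.map_evolve (hinv : IsInvariant P w ξ ν) (hξ : IsNoise P ξ) (s : ℤ) (n : ℕ) :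
    (ν.prod P).map (fun x => evolve w (fun t k => ξ t k x.2) s x.1 n) = ν := by
  have hmeas : ∀ n : ℕ, Measurable fun x : (ℤ → ℝ) × Ω =>
      evolve w (fun t k => ξ t k x.2) s x.1 n := fun n =>
    measurable_evolve w (Z := fun t x k => ξ t k x.2) s n measurable_fst
      fun t _ => (hξ.measurable_row t).comp measurable_snd
  have hrow : ∀ t, Measurable fun x : (ℤ → ℝ) × Ω => fun k => ξ t k x.2 :=
    fun t => (hξ.measurable_row t).comp measurable_snd
  have hstep : Measurable fun p : (ℤ → ℝ) × (ℤ → ℝ) => incrementStep w p.1 p.2 :=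
    measurable_incrementStep w measurable_fst measurable_snd
  have : IsProbabilityMeasure (rowLaw P ξ) :=
    Measure.isProbabilityMeasure_map (hξ.measurable_row 0).aemeasurable
  -- Invariance is stated with the noise at time 1; in terms of the row law it applies at every
  -- time.
  have hinv' : (ν.prod (rowLaw P ξ)).map (fun p => incrementStep w p.1 p.2) = ν := by
    have h1 := (MeasurePreserving.id ν).prod (hξ.measurePreserving_row 1)
    rw [← h1.map_eq, Measure.map_map hstep h1.measurable]
    exact hinv
  induction n with
  | zero => exact Measure.map_fst_prod.trans (by simp)
  | succ n ih =>
    have hpair : (ν.prod P).map (fun x => (evolve w (fun t k => ξ t k x.2) s x.1 n,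
        fun k => ξ (s + n + 1) k x.2)) = ν.prod (rowLaw P ξ) := by
      refine (Measure.prod_eq fun A B hA hB => ?_).symm
      rw [Measure.map_apply ((hmeas n).prodMk (hrow _)) (hA.prod hB),
        Measure.prod_apply (((hmeas n).prodMk (hrow _)) (hA.prod hB))]
      have h1 : ∀ η : ℤ → ℝ, P (Prod.mk η ⁻¹' ((fun x : (ℤ → ℝ) × Ω =>
          (evolve w (fun t k => ξ t k x.2) s x.1 n, fun k => ξ (s + n + 1) k x.2)) ⁻¹' A ×ˢ B))
          = P (Prod.mk η ⁻¹' ((fun x : (ℤ → ℝ) × Ω =>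
            evolve w (fun t k => ξ t k x.2) s x.1 n) ⁻¹' A)) * rowLaw P ξ B := by
        intro η
        rw [← hξ.map_row (s + n + 1), Measure.map_apply (hξ.measurable_row _) hB]
        exact (hξ.indepFun_evolve s n η).measure_inter_preimage_eq_mul A B hA hB
      simp only [h1]
      rw [lintegral_mul_const _ (measurable_measure_prodMk_left (hmeas n hA)),
        ← Measure.prod_apply (hmeas n hA), ← Measure.map_apply (hmeas n) hA, ih]
    have hcomp : (fun x : (ℤ → ℝ) × Ω => evolve w (fun t k => ξ t k x.2) s x.1 (n + 1))
        = (fun p : (ℤ → ℝ) × (ℤ → ℝ) => incrementStep w p.1 p.2) ∘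
          fun x => (evolve w (fun t k => ξ t k x.2) s x.1 n, fun k => ξ (s + n + 1) k x.2) := rfl
    rw [hcomp, ← Measure.map_map hstep ((hmeas n).prodMk (hrow _)), hpair, hinv']

end Law

/-! ### Loss of memory of the initial configuration -/

/-- Along a subsequence, the iterated averages of a stationary ergodic configuration tend almost
surely to the mean, at all sites. -/
theorem exists_seq_ae_tendsto_koopman_iterate_eval {ν : Measure (ℤ → ℝ)} [IsProbabilityMeasure ν]
    {w : ℤ →₀ ℝ} (hw : IsWeight w) (hshift : IsShiftInvariant ν) (herg : IsSpatiallyErgodic ν)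
    (hint : Integrable (fun η : ℤ → ℝ => η 0) ν) :
    ∃ ns : ℕ → ℕ, StrictMono ns ∧ ∀ᵐ η ∂ν, ∀ i : ℤ,
      Tendsto (fun j => (koopman w)^[ns j] (fun η => η i) η) atTop (𝓝 (∫ η, η 0 ∂ν)) := by
  have hμ := hshift.measurePreserving
  set c := ∫ η : ℤ → ℝ, η 0 ∂ν with hc
  have hF : Integrable (fun η : ℤ → ℝ => η 0 - c) ν := hint.sub (integrable_const c)
  have hF0 : ∫ η : ℤ → ℝ, (η 0 - c) ∂ν = 0 := by
    rw [integral_sub hint (integrable_const c)]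
    simp [hc]
  have hlim := tendsto_eLpNorm_one_koopman_iterate hw hμ (herg.ergodic hshift) hF hF0
  have hdec : ∀ n, (koopman w)^[n] (fun η : ℤ → ℝ => η 0)
      = (koopman w)^[n] (fun η => η 0 - c) + fun _ => c := by
    intro n
    rw [← hw.koopman_iterate_const n c, ← koopman_iterate_add]
    congr 1
    funext η
    simp
  have hm : ∀ n, Measurable ((koopman w)^[n] fun η : ℤ → ℝ => η 0) :=
    measurable_koopman_iterate (measurable_pi_apply 0)
  have hmeas : TendstoInMeasure ν (fun n => (koopman w)^[n] fun η : ℤ → ℝ => η 0) atTop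
      fun _ => c := by
    refine tendstoInMeasure_of_tendsto_eLpNorm one_ne_zero
      (fun n => (hm n).aestronglyMeasurable) aestronglyMeasurable_const ?_
    refine hlim.congr fun n => ?_
    rw [hdec]
    congr 1
    funext η
    simp
  obtain ⟨ns, hns, hae⟩ := hmeas.exists_seq_tendsto_ae
  refine ⟨ns, hns, ae_all_iff.2 fun i => ?_⟩
  -- Site `i` of `η` is site `0` of `shift i η`, so one subsequence serves all sites.
  filter_upwards [(hμ i).quasiMeasurePreserving.ae hae] with η hη
  refine hη.congr fun j => ?_
  rw [koopman_iterate_eval_shift, zero_add]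

end Harness

/-! ### Identification of `ν` -/

open Harness in
theorem theorem2p3 {Ω : Type*} [MeasurableSpace Ω] (P : Measure Ω) [IsProbabilityMeasure P]
    (w : ℤ →₀ ℝ) (hw : Harness.IsWeight w)
    (ξ : ℤ → ℤ → Ω → ℝ) (hξ : Harness.IsNoise P ξ)
    (ν : Measure (ℤ → ℝ)) [IsProbabilityMeasure ν]
    (hinv : Harness.IsInvariant P w ξ ν)
    (hshift : Harness.IsShiftInvariant ν)
    (herg : Harness.IsSpatiallyErgodic ν)
    (c : ℝ) (hint : Integrable (fun η : ℤ → ℝ => η 0) ν) (hmean : ∫ η, η 0 ∂ν = c) :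
    (∀ᵐ ω ∂P, ∀ i : ℤ, Tendsto (fun s : ℕ => Harness.flatIncrement w (fun t k => ξ t k ω) 0 s i)
      atTop (𝓝 (Harness.Delta w (fun t k => ξ t k ω) 0 i))) ∧
    ν = Harness.piLaw P w ξ c := by
  have hconv := hξ.ae_tendsto_flatIncrement hw
  refine ⟨hconv, ?_⟩
  obtain ⟨ns, hns, hns_lim⟩ := exists_seq_ae_tendsto_koopman_iterate_eval hw hshift herg hint
  rw [hmean] at hns_lim
  have hevolve : ∀ n : ℕ, Measurable fun x : (ℤ → ℝ) × Ω =>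
      evolve w (fun t k => ξ t k x.2) (-n) x.1 n := fun n =>
    measurable_evolve w (Z := fun t x k => ξ t k x.2) (-n) n measurable_fst
      fun t _ => (hξ.measurable_row t).comp measurable_snd
  have hflat : ∀ (n : ℕ) (i : ℤ),
      Measurable fun ω => flatIncrement w (fun t k => ξ t k ω) 0 n i := by
    intro n i
    simp only [flatIncrement_eq_evolve]
    exact (measurable_pi_apply i).comp (measurable_evolve w (X := fun _ => 0)
      (Z := fun t ω k => ξ t k ω) (-n) n measurable_const fun t _ => hξ.measurable_row t)
  -- `limUnder` is arbitrary where the limit fails to exist, so measurability is obtained almost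
  -- everywhere.
  have hDelta : AEMeasurable (fun ω (x : ℤ) => c + Delta w (fun t k => ξ t k ω) 0 x) P :=
    aemeasurable_pi_lambda _ fun i => (aemeasurable_of_tendsto_metrizable_ae atTop
      (fun n => (hflat n i).aemeasurable)
      (hconv.mono fun ω hω => hω i)).const_add c
  have hsnd : (ν.prod P).map Prod.snd = P := by simp
  have hlim : TendstoInDistribution (fun (j : ℕ) (x : (ℤ → ℝ) × Ω) =>
      evolve w (fun t k => ξ t k x.2) (-(ns j)) x.1 (ns j)) atTop
      (fun x i => c + Delta w (fun t k => ξ t k x.2) 0 i) (fun _ => ν.prod P) (ν.prod P) := by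
    refine tendstoInDistribution_of_ae_tendsto (fun j => (hevolve (ns j)).aemeasurable)
      (AEMeasurable.comp_quasiMeasurePreserving hDelta Measure.quasiMeasurePreserving_snd) ?_
    filter_upwards [Measure.quasiMeasurePreserving_fst.ae hns_lim,
      Measure.quasiMeasurePreserving_snd.ae hconv] with x hx1 hx2
    refine tendsto_pi_nhds.2 fun i => ?_
    refine ((hx1 i).add ((hx2 i).comp hns.tendsto_atTop)).congr fun j => ?_
    rw [evolve_apply, Function.comp, flatIncrement_eq_evolve]
  -- The same variables all have law `ν`, so they also converge in distribution to `ν`; uniqueness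
  -- of limits concludes.
  have hconst : TendstoInDistribution (fun (j : ℕ) (x : (ℤ → ℝ) × Ω) =>
      evolve w (fun t k => ξ t k x.2) (-(ns j)) x.1 (ns j)) atTop
      (fun η : ℤ → ℝ => η) (fun _ => ν.prod P) ν := by
    refine ⟨fun j => (hevolve (ns j)).aemeasurable, aemeasurable_id, ?_⟩
    refine tendsto_const_nhds.congr fun j => ?_
    refine Subtype.ext ?_
    simp only
    rw [hinv.map_evolve hξ, Measure.map_id']
  have heq := tendstoInDistribution_unique _ hconst hlim
  rw [Measure.map_id'] at heq
  rw [heq, piLaw]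
  conv_rhs => rw [← hsnd]
  rw [AEMeasurable.map_map_of_aemeasurable (by rwa [hsnd]) measurable_snd.aemeasurable]
  rfl
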